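/- Let $Q$ be a smooth finite-dimensional manifold, $\pi_Q:T^*Q\to Q$ its cotangent bundle, $\theta$ the Liouville 1-form ($\theta_p(w)=p(T\pi_Q\,w)$) and $\omega_Q=-d\theta$ the canonical symplectic form. Let $L:TQ\to\mathbb{R}$ be smooth, let $FL:TQ\to T^*Q$, $\langle FL(v),w\rangle=\frac{d}{dt}\big|_{t=0}L(v+tw)$, be its Legendre transformation, and let $E_L=\Delta(L)-L$ be its energy, where $\Delta$ is the Liouville (dilation) vector field of $TQ$. Assume that $L$ is almost regular: $M_1=FL(TQ)$ is an (embedded) submanifold of $T^*Q$, and the restricted map $FL_1:TQ\to M_1$ is a submersion with connected fibres. Let $j_1:M_1\to T^*Q$ be the inclusion, $\pi_1=\pi_Q\circ j_1$, $\omega_1=j_1^*\omega_Q$. Let $h_1:M_1\to\mathbb{R}$ be the projection of $E_L$ to $M_1$; that is, $h_1(p)$ is the value of $E_L$ at a point of the fibre $FL_1^{-1}(p)$. Suppose that there is a smooth vector field $X$ on $M_1$ with $i_X\omega_1=dh_1$ at every point of $M_1$. Let $\gamma$ be a smooth closed 1-form on $Q$ with $\gamma(Q)\subset M_1$, let $\gamma_1:Q\to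 M_1$ be $\gamma$ with codomain restricted to $M_1$, and set $X^\gamma=T\pi_1\circ X\circ\gamma_1$, a vector field on $Q$. Then $E_L$ is constant on the fibres of $FL_1$, so that $h_1\circ FL_1=E_L$; the maps $h_1$ and $\gamma_1$ are smooth; and $$X^\gamma\text{ and }X\text{ are }\gamma_1\text{-related, i.e. }T\gamma_1\circ X^\gamma=X\circ\gamma_1\quad\Longleftrightarrow\quad d(h_1\circ\gamma_1)=0 .$$ -/

import Mathlib

open Set Manifold
open scoped ContDiff

noncomputable section

namespace SingularHJ

/-! ### Differential forms on manifolds -/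

section Forms

variable {E H M : Type*} [NormedAddCommGroup E] [NormedSpace ℝ E] [TopologicalSpace H]
  (I : ModelWithCorners ℝ E H) [TopologicalSpace M] [ChartedSpace H M]

/-- The local representative, on the model vector space, of a 1-form `α` in the chart at `x`:
the pullback of `α` under the inverse of that chart. -/
def formInChart (α : ∀ y : M, TangentSpace I y →L[ℝ] ℝ) (x : M) : E → E →L[ℝ] ℝ :=
  fun z => (α ((extChartAt I x).symm z)).comp
    (mfderivWithin 𝓘(ℝ, E) I (extChartAt I x).symm (range I) z)

/-- The exterior derivative of a 1-form `α` at `x`, computed in the chart at `x`: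
`dα(u, v) = D_u a(v) - D_v a(u)`, where `a` is the local representative of `α` and `u`, `v` are
transported by the differential of the chart. -/
def exteriorDeriv (α : ∀ y : M, TangentSpace I y →L[ℝ] ℝ) (x : M)
    (u v : TangentSpace I x) : ℝ :=
  let φ : TangentSpace I x →L[ℝ] E := mfderiv I 𝓘(ℝ, E) (extChartAt I x) x
  let A : E →L[ℝ] E →L[ℝ] ℝ := fderivWithin ℝ (formInChart I α x) (range I) (extChartAt I x x)
  A (φ u) (φ v) - A (φ v) (φ u)

end Forms

/-! ### The cotangent bundle and its canonical forms -/

section Cotangent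

variable (E Q : Type*) [NormedAddCommGroup E] [NormedSpace ℝ E]
  [TopologicalSpace Q] [ChartedSpace E Q]

/-- The cotangent space `T_q^*Q`. -/
abbrev CotangentSpace (q : Q) : Type _ :=
  TangentSpace 𝓘(ℝ, E) q →L[ℝ] Bundle.Trivial Q ℝ q

variable [IsManifold 𝓘(ℝ, E) ∞ Q]

/-- The tangent bundle `TQ`. -/
abbrev TQ : Type _ := TangentBundle 𝓘(ℝ, E) Q

/-- The cotangent bundle `T^*Q`, with the topology and smooth structure of Mathlib's bundle of
continuous linear maps. -/
abbrev TstarQ : Type _ := Bundle.TotalSpace (E →L[ℝ] ℝ) (CotangentSpace E Q)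

/-- The model with corners (without boundary) of `T^*Q`. -/
abbrev modelTstarQ :
    ModelWithCorners ℝ (E × (E →L[ℝ] ℝ)) (ModelProd E (E →L[ℝ] ℝ)) :=
  𝓘(ℝ, E).prod 𝓘(ℝ, E →L[ℝ] ℝ)

variable {E Q}

/-- The canonical projection `π_Q : T^*Q → Q`. -/
def cotangentProj (p : TstarQ E Q) : Q := p.proj

/-- The canonical (Liouville) 1-form `θ_p(w) = p(Tπ_Q w)` of `T^*Q`, locally `p_A dq^A`. -/
def liouvilleForm (p : TstarQ E Q) : TangentSpace (modelTstarQ E) p →L[ℝ] ℝ :=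
  ContinuousLinearMap.comp (M₂ := TangentSpace 𝓘(ℝ, E) p.proj) (M₃ := ℝ) p.snd
    (mfderiv (modelTstarQ E) 𝓘(ℝ, E) (cotangentProj (E := E) (Q := Q)) p)

/-- The canonical symplectic form `ω_Q = - dθ` of `T^*Q`, locally `dq^A ∧ dp_A`. -/
def canonicalForm (p : TstarQ E Q) (u v : TangentSpace (modelTstarQ E) p) : ℝ :=
  - exteriorDeriv (modelTstarQ E) (liouvilleForm (E := E) (Q := Q)) p u v

/-- A 1-form on `Q`, viewed as a map `Q → T^*Q`. -/
def formMap (γ : ∀ q : Q, CotangentSpace E Q q) (q : Q) : TstarQ E Q := ⟨q, γ q⟩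

/-- `γ` is a smooth closed 1-form on `Q`. -/
structure IsClosedOneForm (γ : ∀ q : Q, CotangentSpace E Q q) : Prop where
  smooth : ContMDiff 𝓘(ℝ, E) (modelTstarQ E) ∞ (formMap γ)
  closed : ∀ (q : Q) (u v : TangentSpace 𝓘(ℝ, E) q), exteriorDeriv 𝓘(ℝ, E) γ q u v = 0

end Cotangent

/-! ### Lagrangians -/

section Lagrangian

variable {E Q : Type*} [NormedAddCommGroup E] [NormedSpace ℝ E]
  [TopologicalSpace Q] [ChartedSpace E Q] [IsManifold 𝓘(ℝ, E) ∞ Q]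

/-- The vertical lift at `v ∈ T_qQ` of `w ∈ T_qQ`: the velocity at `t = 0` of `t ↦ v + t w`,
that is, the differential at `v` of the inclusion of the fibre `T_qQ` in `TQ`, applied to `w`. -/
def vlift (v : TQ E Q) :
    TangentSpace 𝓘(ℝ, E) v.proj →L[ℝ] TangentSpace 𝓘(ℝ, E).tangent v :=
  mfderiv 𝓘(ℝ, E) 𝓘(ℝ, E).tangent
    (fun u : E => (Bundle.TotalSpace.mk v.proj u : TQ E Q)) (v.snd : E)

/-- The differential of a Lagrangian `L : TQ → ℝ`. -/
def dLagr (L : TQ E Q → ℝ) (v : TQ E Q) : TangentSpace 𝓘(ℝ, E).tangent v →L[ℝ] ℝ :=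
  mfderiv 𝓘(ℝ, E).tangent 𝓘(ℝ, ℝ) L v

/-- The Legendre transformation `FL : TQ → T^*Q`, `⟨FL(v), w⟩ = dL(w^{vertical lift at v})`,
locally `(q, q̇) ↦ (q, ∂L/∂q̇)`. -/
def legendre (L : TQ E Q → ℝ) (v : TQ E Q) : TstarQ E Q :=
  ⟨v.proj, (dLagr L v).comp (vlift v)⟩

/-- The Liouville vector field `Δ` on `TQ`, locally `q̇^A ∂/∂q̇^A`. -/
def liouvilleField (v : TQ E Q) : TangentSpace 𝓘(ℝ, E).tangent v := vlift v v.snd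

/-- The energy `E_L = Δ(L) - L`. -/
def energy (L : TQ E Q → ℝ) (v : TQ E Q) : ℝ := dLagr L v (liouvilleField v) - L v

/-- The primary constraint set `M₁ = FL(TQ) ⊆ T^*Q`, with the subspace topology. -/
abbrev M₁ (L : TQ E Q → ℝ) : Type _ := range (legendre L)

/-- The inclusion `j₁ : M₁ → T^*Q`. -/
def incl (L : TQ E Q → ℝ) : M₁ L → TstarQ E Q := Subtype.val

/-- The corestriction `FL₁ : TQ → M₁` of the Legendre transformation. -/
def legendre₁ (L : TQ E Q → ℝ) : TQ E Q → M₁ L := rangeFactorization (legendre L)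

/-- The projection `π₁ : M₁ → Q`, the restriction of `π_Q`. -/
def proj₁ (L : TQ E Q → ℝ) : M₁ L → Q := fun p => cotangentProj (incl L p)

/-- The function `h₁ : M₁ → ℝ` onto which the energy projects: its value at `p` is the value of
`E_L` at a point of the fibre of `FL₁` over `p`. -/
def h₁ (L : TQ E Q → ℝ) (p : M₁ L) : ℝ := energy L p.2.choose

/-- The restriction `γ₁ : Q → M₁` of a 1-form `γ` on `Q` with `γ(Q) ⊆ M₁`. -/
def restrict₁ (L : TQ E Q → ℝ) (γ : ∀ q : Q, CotangentSpace E Q q)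
    (hγ : range (formMap γ) ⊆ range (legendre L)) : Q → M₁ L :=
  fun q => ⟨formMap γ q, hγ (mem_range_self q)⟩

variable (E₁ : Type*) [NormedAddCommGroup E₁] [NormedSpace ℝ E₁]

/-- `L` is an almost regular Lagrangian: it is smooth, `M₁ = FL(TQ)`, with the given smooth
structure modelled on `E₁`, is an (embedded) submanifold of `T^*Q`, and `FL₁ : TQ → M₁` is a
submersion with connected fibres. -/
structure IsAlmostRegular (L : TQ E Q → ℝ) [ChartedSpace E₁ (M₁ L)] : Prop where
  smooth : ContMDiff 𝓘(ℝ, E).tangent 𝓘(ℝ, ℝ) ∞ L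
  embedding : IsSmoothEmbedding 𝓘(ℝ, E₁) (modelTstarQ E) ∞ (incl L)
  submersion : IsSubmersion 𝓘(ℝ, E).tangent 𝓘(ℝ, E₁) ∞ (legendre₁ L)
  connected_fibres : ∀ p : M₁ L, IsConnected (legendre₁ L ⁻¹' {p})

variable (L : TQ E Q → ℝ) [ChartedSpace E₁ (M₁ L)]

/-- The presymplectic form `ω₁ = j₁^* ω_Q` on `M₁`. -/
def omega₁ (p : M₁ L) (u v : TangentSpace 𝓘(ℝ, E₁) p) : ℝ :=
  canonicalForm (incl L p) (mfderiv 𝓘(ℝ, E₁) (modelTstarQ E) (incl L) p u)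
    (mfderiv 𝓘(ℝ, E₁) (modelTstarQ E) (incl L) p v)

/-- `X` is a global dynamics: a smooth vector field on `M₁` with `i_X ω₁ = dh₁` everywhere. -/
structure IsGlobalDynamics [IsManifold 𝓘(ℝ, E₁) ∞ (M₁ L)]
    (X : ∀ p : M₁ L, TangentSpace 𝓘(ℝ, E₁) p) : Prop where
  smooth : ContMDiff 𝓘(ℝ, E₁) 𝓘(ℝ, E₁).tangent ∞
    (fun p => (⟨p, X p⟩ : TangentBundle 𝓘(ℝ, E₁) (M₁ L)))
  equation : ∀ (p : M₁ L) (w : TangentSpace 𝓘(ℝ, E₁) p),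
    omega₁ E₁ L p (X p) w = mfderiv 𝓘(ℝ, E₁) 𝓘(ℝ, ℝ) (h₁ L) p w

/-- The vector field `X^γ = Tπ₁ ∘ X ∘ γ₁` on `Q`. -/
def projectedField (X : ∀ p : M₁ L, TangentSpace 𝓘(ℝ, E₁) p)
    (γ : ∀ q : Q, CotangentSpace E Q q) (hγ : range (formMap γ) ⊆ range (legendre L))
    (q : Q) : TangentSpace 𝓘(ℝ, E) q :=
  mfderiv 𝓘(ℝ, E₁) 𝓘(ℝ, E) (proj₁ L) (restrict₁ L γ hγ q) (X (restrict₁ L γ hγ q))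

end Lagrangian

/-- Vector fields `Y` on `M` and `X` on `N` are `f`-related: `Tf ∘ Y = X ∘ f`. -/
def AreRelated {E H M E' H' N : Type*} [NormedAddCommGroup E] [NormedSpace ℝ E]
    [TopologicalSpace H] (I : ModelWithCorners ℝ E H) [TopologicalSpace M] [ChartedSpace H M]
    [NormedAddCommGroup E'] [NormedSpace ℝ E'] [TopologicalSpace H']
    (J : ModelWithCorners ℝ E' H') [TopologicalSpace N] [ChartedSpace H' N]
    (f : M → N) (Y : ∀ x : M, TangentSpace I x) (X : ∀ y : N, TangentSpace J y) : Prop :=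
  ∀ x : M, mfderiv I J f x (Y x) = X (f x)

end SingularHJ

end

noncomputable section

namespace SingularHJ

open Filter
open scoped Topology

/-! ### Local normal forms of submersions and immersions -/

section LocalForms

variable {E E' H H' M N : Type*} [NormedAddCommGroup E] [NormedSpace ℝ E]
  [NormedAddCommGroup E'] [NormedSpace ℝ E'] [TopologicalSpace H] [TopologicalSpace H']
  {I : ModelWithCorners ℝ E H} {J : ModelWithCorners ℝ E' H'}
  [TopologicalSpace M] [ChartedSpace H M] [TopologicalSpace N] [ChartedSpace H' N]
  {n : WithTop ℕ∞} {f : M → N} {x : M}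

/-! A fibre of `FL` over `p` lies in a single tangent space, where `E_L` agrees with `w ↦ p(w) -
L(w)`. The differential of this function vanishes at every point of the fibre, because there the
fibre derivative of `L` is `p`. So `E_L` is constant along paths in the fibre (`energy_eq_of_path`).
The submersion normal form supplies such paths locally, and connectedness makes `E_L` constant on
the whole fibre. Local sections of `FL₁` then give smoothness of `h₁`.

For the equivalence, `ω₁` may be degenerate, so vectors are compared in `T^*Q`, where `ω_Q((a, α),
(b, β)) = β(a) - α(b)` (`canonicalForm_eq`). The equation for `X` gives `d(h₁ ∘ γ₁)(u) = ω_Q(Tj₁ X,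
Tγ u)`, and the image of `Tγ` is isotropic because `γ` is closed. If the fields are related, `Tj₁ X`
lies in that image and the right side vanishes. Conversely, `Tj₁ X - Tγ X^γ` is always vertical, say
`(0, δ)`. If `d(h₁ ∘ γ₁) = 0`, it pairs to `-δ(u) = 0` with every `Tγ u`, so `δ = 0`. Injectivity of
`Tj₁` brings the equality back to `M₁`. -/

/-- The inverse of an extended chart of a boundaryless manifold is `C^n` on the chart domain. -/
theorem contMDiffAt_extend_symm [I.Boundaryless] [IsManifold I n M]
    {e : OpenPartialHomeomorph M H} (he : e ∈ IsManifold.maximalAtlas I n M) {z : E}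
    (hz : z ∈ (e.extend I).target) : ContMDiffAt 𝓘(ℝ, E) I n (e.extend I).symm z := by
  refine (contMDiffOn_extend_symm he).contMDiffAt ?_
  rw [← e.extend_target']
  exact e.isOpen_extend_target.mem_nhds hz

/-- A submersion has a `C^n` local section through every point. -/
theorem _root_.Manifold.IsSubmersionAt.exists_localSection [I.Boundaryless] [IsManifold I n M]
    (h : IsSubmersionAt I J n f x) :
    ∃ s : N → M, s (f x) = x ∧ ContMDiffAt J I n s (f x) ∧ ∀ᶠ y in 𝓝 (f x), f (s y) = y := by
  set φ := h.domChart.extend I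
  set ψ := h.codChart.extend J
  have hx : x ∈ φ.source := by simpa [φ] using h.mem_domChart_source
  have hfx : f x ∈ ψ.source := by simpa [ψ] using h.mem_codChart_source
  have hw := h.writtenInCharts
  have hφx : φ x ∈ φ.target := φ.map_source hx
  have hψx : ψ (f x) = (h.equiv (φ x)).1 := by
    have := hw hφx
    simpa [φ, ψ, h.mem_domChart_source] using this
  -- In these charts `f` is the first projection; the section freezes the second component at its
  -- value at `x`.
  let k : N → E := fun y => h.equiv.symm (ψ y, (h.equiv (φ x)).2)
  have hk : k (f x) = φ x := by simp [k, hψx]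
  have hkc : ContMDiffAt J 𝓘(ℝ, E) n k (f x) := by
    have h1 : ContMDiffAt J 𝓘(ℝ, E') n ψ (f x) :=
      h.codChart.contMDiffAt_extend h.codChart_mem_maximalAtlas h.mem_codChart_source
    have h2 : ContDiff ℝ n (fun z : E' => h.equiv.symm (z, (h.equiv (φ x)).2)) := by fun_prop
    exact h2.contMDiff.contMDiffAt.comp (f x) h1
  have hφs : ContMDiffAt 𝓘(ℝ, E) I n φ.symm (k (f x)) := by
    rw [hk]; exact contMDiffAt_extend_symm h.domChart_mem_maximalAtlas hφx
  refine ⟨φ.symm ∘ k, by simp [hk, φ.left_inv hx], hφs.comp (f x) hkc, ?_⟩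
  have e1 : ∀ᶠ y in 𝓝 (f x), k y ∈ φ.target :=
    hkc.continuousAt.eventually_mem
      (by rw [hk]; exact h.domChart.isOpen_extend_target.mem_nhds hφx)
  have e2 : ∀ᶠ y in 𝓝 (f x), y ∈ ψ.source := by
    simp only [ψ, OpenPartialHomeomorph.extend_source]
    exact h.codChart.open_source.mem_nhds h.mem_codChart_source
  filter_upwards [e1, e2] with y hy hy'
  have hs : f (φ.symm (k y)) ∈ ψ.source := by
    simp only [ψ, OpenPartialHomeomorph.extend_source]
    apply h.source_subset_preimage_source
    have := φ.map_target hy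
    simpa [φ] using this
  refine ψ.injOn hs hy' ?_
  have := hw hy
  simpa [k, φ, ψ] using this

/-- Near a given point, the points of the same fibre of a submersion are joined to it by a `C^n`
path contained in that fibre. -/
theorem _root_.Manifold.IsSubmersionAt.eventually_exists_path [I.Boundaryless] [IsManifold I n M]
    (h : IsSubmersionAt I J n f x) :
    ∀ᶠ y in 𝓝 x, f y = f x → ∃ c : ℝ → M, c 0 = x ∧ c 1 = y ∧
      ∀ t ∈ Icc (0 : ℝ) 1, ContMDiffAt 𝓘(ℝ, ℝ) I n c t ∧ f (c t) = f x := by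
  set φ := h.domChart.extend I
  set ψ := h.codChart.extend J
  have hx : x ∈ φ.source := by simpa [φ] using h.mem_domChart_source
  have hw := h.writtenInCharts
  have hφx : φ x ∈ φ.target := φ.map_source hx
  obtain ⟨r, hr, hball⟩ := Metric.isOpen_iff.1 (h.domChart.isOpen_extend_target (I := I)) _ hφx
  have hcont : ContinuousAt φ x := h.domChart.continuousAt_extend h.mem_domChart_source
  have key : ∀ y ∈ φ.source, ψ (f y) = (h.equiv (φ y)).1 := by
    intro y hy
    have := hw (φ.map_source hy)
    simp only [Function.comp_apply] at this
    rwa [show (h.domChart.extend I).symm (φ y) = y from φ.left_inv hy] at this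
  have hsub : ∀ y ∈ φ.source, f y ∈ ψ.source := by
    intro y hy
    simp only [ψ, OpenPartialHomeomorph.extend_source]
    apply h.source_subset_preimage_source
    simpa [φ] using hy
  have e2 : ∀ᶠ y in 𝓝 x, y ∈ φ.source := by
    simp only [φ, OpenPartialHomeomorph.extend_source]
    exact h.domChart.open_source.mem_nhds h.mem_domChart_source
  filter_upwards [hcont.eventually_mem (Metric.ball_mem_nhds _ hr), e2] with y hy hys hfy
  -- The path is a chart segment: it stays in a convex ball inside the target. When its endpoints
  -- share the first component, so do all its points.
  have hseg : ∀ t ∈ Icc (0 : ℝ) 1, AffineMap.lineMap (φ x) (φ y) t ∈ φ.target := by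
    intro t ht
    exact hball ((convex_ball (φ x) r).lineMap_mem (Metric.mem_ball_self hr) hy ht)
  refine ⟨fun t => φ.symm (AffineMap.lineMap (φ x) (φ y) t), by simp [φ.left_inv hx],
    by simp [φ.left_inv hys], fun t ht => ⟨?_, ?_⟩⟩
  · have h1 : ContDiff ℝ n (fun t : ℝ => AffineMap.lineMap (φ x) (φ y) t) := by
      simp only [AffineMap.lineMap_apply, vsub_eq_sub, vadd_eq_add]
      fun_prop
    exact (contMDiffAt_extend_symm h.domChart_mem_maximalAtlas (hseg t ht)).comp t
      h1.contMDiff.contMDiffAt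
  · have hm := φ.map_target (hseg t ht)
    refine ψ.injOn (hsub _ hm) (hsub _ hx) ?_
    rw [key _ hm, key _ hx, φ.right_inv (hseg t ht)]
    have h2 : (h.equiv (φ y)).1 = (h.equiv (φ x)).1 := by rw [← key _ hx, ← key _ hys, hfy]
    simp [AffineMap.lineMap_apply, h2]

/-- The differential of an immersion is injective. -/
theorem _root_.Manifold.IsImmersionAt.mfderiv_injective [I.Boundaryless] [IsManifold I n M]
    (h : IsImmersionAt I J n f x) (hn : n ≠ 0) :
    Function.Injective (mfderiv I J f x) := by
  set φ := h.domChart.extend I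
  set ψ := h.codChart.extend J
  have hx : x ∈ φ.source := by simpa [φ] using h.mem_domChart_source
  have hφx : φ x ∈ φ.target := φ.map_source hx
  have hw := h.writtenInCharts
  -- In the charts `f` is `z ↦ (z, 0)`, so projecting to the first factor yields a local left
  -- inverse of `f`, differentiable at `f x`.
  have key : ∀ y ∈ φ.source, (h.equiv.symm (ψ (f y))).1 = φ y := by
    intro y hy
    have := hw (φ.map_source hy)
    simp only [Function.comp_apply] at this
    rw [show (h.domChart.extend I).symm (φ y) = y from φ.left_inv hy] at this
    rw [show ψ (f y) = h.equiv (φ y, 0) from this]; simp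
  have hψ : ContMDiffAt J 𝓘(ℝ, E') n ψ (f x) :=
    h.codChart.contMDiffAt_extend h.codChart_mem_maximalAtlas h.mem_codChart_source
  have h2 : ContDiff ℝ n (fun z : E' => (h.equiv.symm z).1) := by fun_prop
  have h3 := h2.contMDiff.contMDiffAt.comp (f x) hψ
  have h4 : ContMDiffAt 𝓘(ℝ, E) I n φ.symm (((fun z => (h.equiv.symm z).1) ∘ ψ) (f x)) := by
    rw [Function.comp_apply, key x hx]
    exact contMDiffAt_extend_symm h.domChart_mem_maximalAtlas hφx
  have h5 := h4.comp (f x) h3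
  have h6 := mfderiv_comp x (h5.mdifferentiableAt hn) (h.contMDiffAt.mdifferentiableAt hn)
  have h7 : (φ.symm ∘ ((fun z => (h.equiv.symm z).1) ∘ ψ)) ∘ f =ᶠ[𝓝 x] id := by
    have e2 : ∀ᶠ y in 𝓝 x, y ∈ φ.source := by
      simp only [φ, OpenPartialHomeomorph.extend_source]
      exact h.domChart.open_source.mem_nhds h.mem_domChart_source
    filter_upwards [e2] with y hy
    simp only [Function.comp_apply, key y hy, φ.left_inv hy, id]
  intro u v huv
  have h8 : ∀ w, mfderiv I I ((φ.symm ∘ ((fun z => (h.equiv.symm z).1) ∘ ψ)) ∘ f) x w = w := by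
    intro w
    rw [h7.mfderiv_eq, mfderiv_id]; rfl
  rw [← h8 u, ← h8 v, h6]
  exact congrArg (mfderiv J I _ (f x)) huv

end LocalForms

/-! ### Canonical coordinates on the cotangent bundle -/

section CotangentCoordinates

variable {E Q : Type*} [NormedAddCommGroup E] [NormedSpace ℝ E]
  [TopologicalSpace Q] [ChartedSpace E Q] [IsManifold 𝓘(ℝ, E) ∞ Q]

theorem contMDiff_cotangentProj :
    ContMDiff (modelTstarQ E) 𝓘(ℝ, E) ∞ (cotangentProj (E := E) (Q := Q)) :=
  Bundle.contMDiff_proj _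

/-- The canonical coordinates `(q, p)` of the cotangent bundle. -/
theorem extChartAt_cotangent (p₀ p : TstarQ E Q) :
    extChartAt (modelTstarQ E) p₀ p = (extChartAt 𝓘(ℝ, E) p₀.proj p.proj,
      (p.snd : E →L[ℝ] ℝ).comp
        ((trivializationAt E (TangentSpace 𝓘(ℝ, E)) p₀.proj).symmL ℝ p.proj)) := by
  rw [FiberBundle.extChartAt]
  refine Prod.ext rfl ?_
  change ((trivializationAt ℝ (Bundle.Trivial Q ℝ) p₀.proj).continuousLinearMapAt ℝ p.proj).comp
    ((p.snd : E →L[ℝ] ℝ).comp _) = _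
  exact (congrArg (fun A : ℝ →L[ℝ] ℝ => A.comp _)
    (Bundle.Trivial.continuousLinearMapAt_trivialization ℝ Q ℝ p.proj)).trans
    (ContinuousLinearMap.id_comp _)

theorem proj_mem_chart_source {p₀ p : TstarQ E Q}
    (hp : p ∈ (extChartAt (modelTstarQ E) p₀).source) :
    p.proj ∈ (chartAt E p₀.proj).source := by
  rw [FiberBundle.extChartAt] at hp
  simp only [mfld_simps] at hp
  exact hp.1.1

/-- In canonical coordinates, the differential of `π_Q` is the first projection. -/
theorem mfderiv_cotangentProj (p : TstarQ E Q) (u : E × (E →L[ℝ] ℝ)) :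
    mfderiv (modelTstarQ E) 𝓘(ℝ, E) (cotangentProj (E := E) (Q := Q)) p u = u.1 := by
  have hd : MDifferentiableAt (modelTstarQ E) 𝓘(ℝ, E) (cotangentProj (E := E) (Q := Q)) p :=
    contMDiff_cotangentProj.mdifferentiableAt (by simp)
  rw [hd.mfderiv]
  have h : writtenInExtChartAt (modelTstarQ E) 𝓘(ℝ, E) p (cotangentProj (E := E) (Q := Q))
      =ᶠ[𝓝 (extChartAt (modelTstarQ E) p p)] Prod.fst := by
    filter_upwards [extChartAt_target_mem_nhds (I := modelTstarQ E) p] with z hz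
    have := (extChartAt (modelTstarQ E) p).right_inv hz
    rw [extChartAt_cotangent] at this
    exact congrArg Prod.fst this
  rw [ModelWithCorners.range_eq_univ, fderivWithin_univ, h.fderiv_eq, fderiv_fst]
  rfl

/-- The local representative of a 1-form is its expression in the trivialization. -/
theorem formInChart_apply (γ : ∀ q : Q, CotangentSpace E Q q) (q₀ : Q) {z : E}
    (hz : z ∈ (extChartAt 𝓘(ℝ, E) q₀).target) :
    formInChart 𝓘(ℝ, E) γ q₀ z = (γ ((extChartAt 𝓘(ℝ, E) q₀).symm z) : E →L[ℝ] ℝ).comp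
      ((trivializationAt E (TangentSpace 𝓘(ℝ, E)) q₀).symmL ℝ
        ((extChartAt 𝓘(ℝ, E) q₀).symm z)) := by
  have hs : (extChartAt 𝓘(ℝ, E) q₀).symm z ∈ (chartAt E q₀).source := by
    simpa using (extChartAt 𝓘(ℝ, E) q₀).map_target hz
  rw [TangentBundle.symmL_trivializationAt hs, (extChartAt 𝓘(ℝ, E) q₀).right_inv hz]
  rfl

/-- The differential of a 1-form `γ : Q → T^*Q` in canonical coordinates. -/
theorem mfderiv_formMap {γ : ∀ q : Q, CotangentSpace E Q q}
    (hγ : ContMDiff 𝓘(ℝ, E) (modelTstarQ E) ∞ (formMap γ)) (q : Q)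
    (u : TangentSpace 𝓘(ℝ, E) q) :
    mfderiv 𝓘(ℝ, E) (modelTstarQ E) (formMap γ) q u =
      ((u, fderiv ℝ (formInChart 𝓘(ℝ, E) γ q) (extChartAt 𝓘(ℝ, E) q q) u) :
        E × (E →L[ℝ] ℝ)) := by
  have hd : MDifferentiableAt 𝓘(ℝ, E) (modelTstarQ E) (formMap γ) q :=
    hγ.mdifferentiableAt (by simp)
  have h : writtenInExtChartAt 𝓘(ℝ, E) (modelTstarQ E) q (formMap γ)
      =ᶠ[𝓝 (extChartAt 𝓘(ℝ, E) q q)] fun z => (z, formInChart 𝓘(ℝ, E) γ q z) := by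
    filter_upwards [extChartAt_target_mem_nhds (I := 𝓘(ℝ, E)) q] with z hz
    rw [formInChart_apply γ q hz]
    simp only [writtenInExtChartAt, Function.comp_apply, extChartAt_cotangent]
    exact Prod.ext ((extChartAt 𝓘(ℝ, E) q).right_inv hz) rfl
  have hd' := hd.2
  rw [DifferentiableWithinAtProp] at hd'
  have hd₂ : DifferentiableAt ℝ (writtenInExtChartAt 𝓘(ℝ, E) (modelTstarQ E) q (formMap γ))
      (extChartAt 𝓘(ℝ, E) q q) := by
    simpa [differentiableWithinAt_univ] using hd'
  have hd₃ : DifferentiableAt ℝ (formInChart 𝓘(ℝ, E) γ q) (extChartAt 𝓘(ℝ, E) q q) :=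
    (h.differentiableAt_iff.1 hd₂).snd
  rw [hd.mfderiv, ModelWithCorners.range_eq_univ, fderivWithin_univ, h.fderiv_eq,
    differentiableAt_fun_id.fderiv_prodMk hd₃]
  simp only [fderiv_fun_id]
  rfl

/-- In canonical coordinates, `θ = p dq`. -/
theorem formInChart_liouvilleForm (p : TstarQ E Q) :
    formInChart (modelTstarQ E) (liouvilleForm (E := E) (Q := Q)) p
      =ᶠ[𝓝 (extChartAt (modelTstarQ E) p p)]
      fun z => z.2.comp (ContinuousLinearMap.fst ℝ E (E →L[ℝ] ℝ)) := by
  filter_upwards [extChartAt_target_mem_nhds (I := modelTstarQ E) p] with z hz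
  set p' := (extChartAt (modelTstarQ E) p).symm z
  have hz' := (extChartAt (modelTstarQ E) p).right_inv hz
  rw [extChartAt_cotangent] at hz'
  have hz₁ : extChartAt 𝓘(ℝ, E) p.proj p'.proj = z.1 := congrArg Prod.fst hz'
  have hz₂ := congrArg Prod.snd hz'
  have hmem : ∀ z' ∈ (extChartAt (modelTstarQ E) p).target,
      z'.1 ∈ (extChartAt 𝓘(ℝ, E) p.proj).target := by
    intro z' h
    rw [FiberBundle.extChartAt_target] at h
    exact h.1.1
  have hsrc : p'.proj ∈ (chartAt E p.proj).source :=
    proj_mem_chart_source ((extChartAt (modelTstarQ E) p).map_target hz)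
  have hcomp : cotangentProj ∘ (extChartAt (modelTstarQ E) p).symm =ᶠ[𝓝 z]
      (extChartAt 𝓘(ℝ, E) p.proj).symm ∘ Prod.fst := by
    filter_upwards [(isOpen_extChartAt_target p).mem_nhds hz] with z' hz'
    have h1 := (extChartAt (modelTstarQ E) p).right_inv hz'
    have h2 := proj_mem_chart_source ((extChartAt (modelTstarQ E) p).map_target hz')
    rw [extChartAt_cotangent] at h1
    rw [Function.comp_apply, Function.comp_apply, ← congrArg Prod.fst h1]
    refine ((extChartAt 𝓘(ℝ, E) p.proj).left_inv ?_).symm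
    rwa [extChartAt_source]
  have hsymm : MDifferentiableAt 𝓘(ℝ, E) 𝓘(ℝ, E) (extChartAt 𝓘(ℝ, E) p.proj).symm z.1 := by
    have := mdifferentiableWithinAt_extChartAt_symm (hmem z hz)
    rwa [ModelWithCorners.range_eq_univ, mdifferentiableWithinAt_univ] at this
  have hsymm' : MDifferentiableAt 𝓘(ℝ, E × (E →L[ℝ] ℝ)) (modelTstarQ E)
      (extChartAt (modelTstarQ E) p).symm z := by
    have := mdifferentiableWithinAt_extChartAt_symm hz
    rwa [ModelWithCorners.range_eq_univ, mdifferentiableWithinAt_univ] at this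
  have hd : (mfderiv (modelTstarQ E) 𝓘(ℝ, E) cotangentProj p').comp
      (mfderiv 𝓘(ℝ, E × (E →L[ℝ] ℝ)) (modelTstarQ E) (extChartAt (modelTstarQ E) p).symm z) =
      (mfderiv 𝓘(ℝ, E) 𝓘(ℝ, E) (extChartAt 𝓘(ℝ, E) p.proj).symm z.1).comp
        (ContinuousLinearMap.fst ℝ E (E →L[ℝ] ℝ)) := by
    rw [← mfderiv_comp z (contMDiff_cotangentProj.mdifferentiableAt (by simp)) hsymm',
      hcomp.mfderiv_eq, mfderiv_comp z hsymm differentiableAt_fst.mdifferentiableAt,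
      mfderiv_eq_fderiv, fderiv_fst]
    rfl
  -- The momentum coordinate of `z` is `p'.snd` composed with the differential of the inverse base
  -- chart, the same factor that appears in `hd`.
  rw [TangentBundle.symmL_trivializationAt hsrc, hz₁] at hz₂
  rw [← hz₂]
  simp only [ModelWithCorners.range_eq_univ, mfderivWithin_univ, formInChart, liouvilleForm]
  refine ContinuousLinearMap.ext fun w => ?_
  exact congrArg (p'.snd : E →L[ℝ] ℝ) (DFunLike.congr_fun hd w)

/-- In canonical coordinates, `ω_Q = dq ∧ dp`. -/
theorem canonicalForm_eq (p : TstarQ E Q) (u v : E × (E →L[ℝ] ℝ)) :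
    canonicalForm p u v = v.2 u.1 - u.2 v.1 := by
  have h : fderiv ℝ (formInChart (modelTstarQ E) (liouvilleForm (E := E) (Q := Q)) p)
      (extChartAt (modelTstarQ E) p p) =
      ((ContinuousLinearMap.compL ℝ (E × (E →L[ℝ] ℝ)) E ℝ).flip
        (ContinuousLinearMap.fst ℝ E (E →L[ℝ] ℝ))).comp
          (ContinuousLinearMap.snd ℝ E (E →L[ℝ] ℝ)) := by
    -- The representative `z ↦ z.2 ∘ fst` is linear in `z`, hence is its own derivative.
    rw [(formInChart_liouvilleForm p).fderiv_eq]
    exact (((ContinuousLinearMap.compL ℝ (E × (E →L[ℝ] ℝ)) E ℝ).flip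
        (ContinuousLinearMap.fst ℝ E (E →L[ℝ] ℝ))).comp
          (ContinuousLinearMap.snd ℝ E (E →L[ℝ] ℝ))).fderiv
  simp only [canonicalForm, exteriorDeriv, mfderiv_extChartAt_self,
    ModelWithCorners.range_eq_univ, fderivWithin_univ, h]
  rw [neg_sub]
  rfl

/-- A closed 1-form has isotropic image: `γ^* ω_Q = - dγ = 0`. -/
theorem canonicalForm_mfderiv_formMap {γ : ∀ q : Q, CotangentSpace E Q q}
    (hγ : IsClosedOneForm γ) (q : Q) (u v : TangentSpace 𝓘(ℝ, E) q) :
    canonicalForm (formMap γ q) (mfderiv 𝓘(ℝ, E) (modelTstarQ E) (formMap γ) q u)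
      (mfderiv 𝓘(ℝ, E) (modelTstarQ E) (formMap γ) q v) = 0 := by
  have h := hγ.closed q u v
  simp only [exteriorDeriv, mfderiv_extChartAt_self, modelWithCornersSelf_coe, range_id,
    fderivWithin_univ] at h
  rw [mfderiv_formMap hγ.smooth, mfderiv_formMap hγ.smooth]
  refine (canonicalForm_eq _ _ _).trans ?_
  rw [← neg_eq_zero, neg_sub]
  exact h

end CotangentCoordinates

/-! ### Fibre derivative and energy -/

section LegendreAndEnergy

variable {E Q : Type*} [NormedAddCommGroup E] [NormedSpace ℝ E]
  [TopologicalSpace Q] [ChartedSpace E Q] [IsManifold 𝓘(ℝ, E) ∞ Q]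
  {L : TQ E Q → ℝ}

/-- The trivialization of the tangent bundle at `q` is the identity on the fibre over `q`. -/
theorem trivializationAt_self (v : TQ E Q) :
    (trivializationAt E (TangentSpace 𝓘(ℝ, E)) v.proj v).2 = v.snd := by
  have h := TangentBundle.continuousLinearMapAt_trivializationAt
    (I := 𝓘(ℝ, E)) (mem_chart_source E v.proj)
  rw [mfderiv_extChartAt_self] at h
  have h2 := DFunLike.congr_fun h v.snd
  rw [Bundle.Trivialization.continuousLinearMapAt_apply,
    Bundle.Trivialization.coe_linearMapAt_of_mem _ (by simp)] at h2
  exact h2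

/-- The inclusion of a fibre in the tangent bundle is smooth. -/
theorem contMDiff_fibreInclusion (q : Q) :
    ContMDiff 𝓘(ℝ, E) 𝓘(ℝ, E).tangent ∞
      (fun u : E => (Bundle.TotalSpace.mk q u : TQ E Q)) := by
  intro u
  rw [Bundle.contMDiffAt_totalSpace]
  refine ⟨contMDiffAt_const, ?_⟩
  have h : (fun u : E => (trivializationAt E (TangentSpace 𝓘(ℝ, E)) q
      (Bundle.TotalSpace.mk q u : TQ E Q)).2) = id := by
    funext u
    exact trivializationAt_self (⟨q, u⟩ : TQ E Q)
  change ContMDiffAt _ _ _ (fun u : E => (trivializationAt E (TangentSpace 𝓘(ℝ, E)) q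
      (Bundle.TotalSpace.mk q u : TQ E Q)).2) u
  rw [h]
  exact contMDiffAt_id

theorem contDiff_restrict_fibre (hL : ContMDiff 𝓘(ℝ, E).tangent 𝓘(ℝ, ℝ) ∞ L) (q : Q) :
    ContDiff ℝ ∞ (fun u : E => L ⟨q, u⟩) :=
  (hL.comp (contMDiff_fibreInclusion q)).contDiff

/-- The Legendre transformation is the fibre derivative of the Lagrangian. -/
theorem legendre_snd_eq_fderiv (hL : ContMDiff 𝓘(ℝ, E).tangent 𝓘(ℝ, ℝ) ∞ L) (v : TQ E Q) :
    ((legendre L v).snd : E →L[ℝ] ℝ) = fderiv ℝ (fun u : E => L ⟨v.proj, u⟩) v.snd := by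
  refine Eq.trans ?_ (mfderiv_eq_fderiv (E := E))
  exact (mfderiv_comp (E := E) (M := E) (I := 𝓘(ℝ, E)) (I' := 𝓘(ℝ, E).tangent) v.snd
    (hL.mdifferentiableAt (by simp))
    ((contMDiff_fibreInclusion (E := E) v.proj).mdifferentiableAt (by simp))).symm

/-- Since `Δ(L)(v) = ⟨FL(v), v⟩`, this term is the bundle pairing of two smooth maps over the same
base map. -/
theorem contMDiff_energy (hL : ContMDiff 𝓘(ℝ, E).tangent 𝓘(ℝ, ℝ) ∞ L)
    (hF : ContMDiff 𝓘(ℝ, E).tangent (modelTstarQ E) ∞ (legendre L)) :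
    ContMDiff 𝓘(ℝ, E).tangent 𝓘(ℝ, ℝ) ∞ (energy L) := by
  have h : ContMDiff 𝓘(ℝ, E).tangent (𝓘(ℝ, E).prod 𝓘(ℝ, ℝ)) ∞
      (fun v : TQ E Q => Bundle.TotalSpace.mk' ℝ (E := Bundle.Trivial Q ℝ) v.proj
        ((legendre L v).snd v.snd)) :=
    ContMDiff.clm_bundle_apply (F₁ := E) (F₂ := ℝ) (E₁ := TangentSpace 𝓘(ℝ, E))
      (E₂ := Bundle.Trivial Q ℝ) (b := fun v : TQ E Q => v.proj) hF contMDiff_id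
  have h' : ContMDiff 𝓘(ℝ, E).tangent 𝓘(ℝ, ℝ) ∞
      (fun v : TQ E Q => ((legendre L v).snd : E →L[ℝ] ℝ) v.snd) :=
    fun v => (Bundle.contMDiffAt_totalSpace.1 (h v)).2
  exact h'.sub hL

/-- On the fibre of `FL` over `p`, the energy is `v ↦ p(v) - L(v)` and the fibre derivative of `L`
is `p`. -/
theorem energy_eq_of_legendre_eq (hL : ContMDiff 𝓘(ℝ, E).tangent 𝓘(ℝ, ℝ) ∞ L)
    {v : TQ E Q} {p : TstarQ E Q} (h : legendre L v = p) :
    v.proj = p.proj ∧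
    energy L v = (p.snd : E →L[ℝ] ℝ) (trivializationAt E (TangentSpace 𝓘(ℝ, E)) p.proj v).2 -
      L ⟨p.proj, (trivializationAt E (TangentSpace 𝓘(ℝ, E)) p.proj v).2⟩ ∧
    fderiv ℝ (fun u : E => L ⟨p.proj, u⟩)
      (trivializationAt E (TangentSpace 𝓘(ℝ, E)) p.proj v).2 = (p.snd : E →L[ℝ] ℝ) := by
  subst h
  have := trivializationAt_self v
  refine ⟨rfl, ?_, ?_⟩
  · change _ = ((legendre L v).snd : E →L[ℝ] ℝ)
        (trivializationAt E (TangentSpace 𝓘(ℝ, E)) v.proj v).2 -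
      L ⟨v.proj, (trivializationAt E (TangentSpace 𝓘(ℝ, E)) v.proj v).2⟩
    rw [this]; rfl
  · change fderiv ℝ (fun u : E => L ⟨v.proj, u⟩)
      (trivializationAt E (TangentSpace 𝓘(ℝ, E)) v.proj v).2 = _
    rw [this, legendre_snd_eq_fderiv hL]

/-- The energy is constant along paths contained in a fibre of the Legendre transformation. -/
theorem energy_eq_of_path (hL : ContMDiff 𝓘(ℝ, E).tangent 𝓘(ℝ, ℝ) ∞ L) {p : TstarQ E Q}
    {c : ℝ → TQ E Q}
    (hc : ∀ t ∈ Icc (0 : ℝ) 1, ContMDiffAt 𝓘(ℝ, ℝ) 𝓘(ℝ, E).tangent ∞ c t ∧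
      legendre L (c t) = p) :
    energy L (c 1) = energy L (c 0) := by
  -- The type of `(c t).snd` varies with `t`; one fixed trivialization turns the path into a curve
  -- in `E`.
  let e := trivializationAt E (TangentSpace 𝓘(ℝ, E)) p.proj
  let u : ℝ → E := fun t => (e (c t)).2
  let g : E → ℝ := fun w => (p.snd : E →L[ℝ] ℝ) w - L ⟨p.proj, w⟩
  have hE : ∀ t ∈ Icc (0 : ℝ) 1, energy L (c t) = g (u t) := fun t ht =>
    (energy_eq_of_legendre_eq hL (hc t ht).2).2.1
  have hg : ∀ t ∈ Icc (0 : ℝ) 1, HasFDerivAt g (0 : E →L[ℝ] ℝ) (u t) := by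
    intro t ht
    have h1 := ((contDiff_restrict_fibre hL p.proj).differentiable (by simp) (u t)).hasFDerivAt
    rw [(energy_eq_of_legendre_eq hL (hc t ht).2).2.2] at h1
    have h2 := ((show E →L[ℝ] ℝ from p.snd).hasFDerivAt (x := u t)).sub h1
    exact h2.congr_fderiv (sub_self (show E →L[ℝ] ℝ from p.snd))
  have hu : ∀ t ∈ Icc (0 : ℝ) 1, DifferentiableAt ℝ u t := by
    intro t ht
    have hp := (energy_eq_of_legendre_eq hL (hc t ht).2).1
    have h1 := (Bundle.contMDiffAt_totalSpace.1 (hc t ht).1).2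
    rw [hp] at h1
    exact (contMDiffAt_iff_contDiffAt.1 h1).differentiableAt (by simp)
  have hd : ∀ t ∈ Icc (0 : ℝ) 1, HasDerivAt (g ∘ u) 0 t := by
    intro t ht
    simpa using (hg t ht).comp_hasDerivAt t (hu t ht).hasDerivAt
  have h := constant_of_has_deriv_right_zero (f := g ∘ u) (a := 0) (b := 1)
    (fun t ht => (hd t ht).continuousAt.continuousWithinAt)
    (fun t ht => (hd t (Ico_subset_Icc_self ht)).hasDerivWithinAt) 1 (by simp)
  rw [hE 1 (by simp), hE 0 (by simp)]
  exact h

end LegendreAndEnergy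

/-! ### The constraint submanifold and the Hamilton–Jacobi equivalence -/

section ConstraintSet

variable {E Q E₁ : Type*} [NormedAddCommGroup E] [NormedSpace ℝ E]
  [TopologicalSpace Q] [ChartedSpace E Q] [IsManifold 𝓘(ℝ, E) ∞ Q]
  [NormedAddCommGroup E₁] [NormedSpace ℝ E₁]
  {L : TQ E Q → ℝ} [ChartedSpace E₁ (M₁ L)]

/-- Smoothness is read off the factorization `FL = j₁ ∘ FL₁`. -/
theorem IsAlmostRegular.contMDiff_legendre (hL : IsAlmostRegular E₁ L) :
    ContMDiff 𝓘(ℝ, E).tangent (modelTstarQ E) ∞ (legendre L) :=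
  hL.embedding.contMDiff.comp hL.submersion.contMDiff

/-- The energy is constant on the fibres of the Legendre transformation. -/
theorem IsAlmostRegular.energy_eq_of_legendre₁_eq (hL : IsAlmostRegular E₁ L) {v w : TQ E Q}
    (h : legendre₁ L v = legendre₁ L w) : energy L v = energy L w := by
  set S := legendre₁ L ⁻¹' {legendre₁ L w}
  have hS : PreconnectedSpace S :=
    isPreconnected_iff_preconnectedSpace.1 (hL.connected_fibres (legendre₁ L w)).isPreconnected
  have hloc : IsLocallyConstant (fun x : S => energy L x) := by
    rw [IsLocallyConstant.iff_eventually_eq]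
    intro x
    have h1 := (hL.submersion.isSubmersionAt x.1).eventually_exists_path
    filter_upwards [continuous_subtype_val.continuousAt.eventually h1] with y hy
    obtain ⟨c, h0, h1, hc⟩ := hy (y.2.trans x.2.symm)
    have := energy_eq_of_path (p := legendre L x.1) hL.smooth
      (fun t ht => ⟨(hc t ht).1, congrArg Subtype.val (hc t ht).2⟩)
    rwa [h0, h1] at this
  exact hloc.apply_eq_of_preconnectedSpace ⟨v, h⟩ ⟨w, rfl⟩

/-- The point chosen in `h₁` lies in the same fibre as `v`. -/
theorem IsAlmostRegular.h₁_legendre₁ (hL : IsAlmostRegular E₁ L) (v : TQ E Q) :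
    h₁ L (legendre₁ L v) = energy L v :=
  hL.energy_eq_of_legendre₁_eq (Subtype.ext (legendre₁ L v).2.choose_spec)

theorem IsAlmostRegular.contMDiff_h₁ (hL : IsAlmostRegular E₁ L) :
    ContMDiff 𝓘(ℝ, E₁) 𝓘(ℝ, ℝ) ∞ (h₁ L) := by
  intro p
  obtain ⟨v, rfl⟩ := rangeFactorization_surjective (f := legendre L) p
  obtain ⟨s, hsv, hs, hfs⟩ := (hL.submersion.isSubmersionAt v).exists_localSection
  have hE : ContMDiffAt 𝓘(ℝ, E).tangent 𝓘(ℝ, ℝ) ∞ (energy L) (s (legendre₁ L v)) :=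
    contMDiff_energy hL.smooth hL.contMDiff_legendre _
  refine (hE.comp (legendre₁ L v) hs).congr_of_eventuallyEq ?_
  filter_upwards [hfs] with y hy
  rw [Function.comp_apply, ← hL.h₁_legendre₁, hy]

/-- A continuous map into an immersed manifold is smooth when its composite with the immersion is;
continuity holds because `M₁` has the subspace topology. -/
theorem IsAlmostRegular.contMDiff_restrict₁ (hL : IsAlmostRegular E₁ L)
    {γ : ∀ q : Q, CotangentSpace E Q q}
    (hγ : ContMDiff 𝓘(ℝ, E) (modelTstarQ E) ∞ (formMap γ))
    (hγM : range (formMap γ) ⊆ range (legendre L)) :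
    ContMDiff 𝓘(ℝ, E) 𝓘(ℝ, E₁) ∞ (restrict₁ L γ hγM) :=
  (ContMDiff.iff_comp_isImmersion hL.embedding.isImmersion).2
    ⟨hγ.continuous.subtype_mk _, hγ⟩

theorem IsAlmostRegular.mfderiv_proj₁ (hL : IsAlmostRegular E₁ L) (p : M₁ L)
    (w : TangentSpace 𝓘(ℝ, E₁) p) :
    mfderiv 𝓘(ℝ, E₁) 𝓘(ℝ, E) (proj₁ L) p w =
      Prod.fst (α := E) (β := E →L[ℝ] ℝ) (mfderiv 𝓘(ℝ, E₁) (modelTstarQ E) (incl L) p w) := by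
  refine Eq.trans ?_ (mfderiv_cotangentProj (incl L p) _)
  have := mfderiv_comp p (contMDiff_cotangentProj.mdifferentiableAt (by simp))
    (hL.embedding.contMDiff.mdifferentiableAt (x := p) (by simp))
  exact DFunLike.congr_fun this w

theorem IsAlmostRegular.mfderiv_incl_restrict₁ (hL : IsAlmostRegular E₁ L)
    {γ : ∀ q : Q, CotangentSpace E Q q}
    (hγ : ContMDiff 𝓘(ℝ, E) (modelTstarQ E) ∞ (formMap γ))
    (hγM : range (formMap γ) ⊆ range (legendre L)) (q : Q) (u : TangentSpace 𝓘(ℝ, E) q) :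
    mfderiv 𝓘(ℝ, E₁) (modelTstarQ E) (incl L) (restrict₁ L γ hγM q)
      (mfderiv 𝓘(ℝ, E) 𝓘(ℝ, E₁) (restrict₁ L γ hγM) q u) =
      mfderiv 𝓘(ℝ, E) (modelTstarQ E) (formMap γ) q u := by
  have := mfderiv_comp q
    (hL.embedding.contMDiff.mdifferentiableAt (x := restrict₁ L γ hγM q) (by simp))
    ((hL.contMDiff_restrict₁ hγ hγM).mdifferentiableAt (x := q) (by simp))
  exact (DFunLike.congr_fun this u).symm

variable [IsManifold 𝓘(ℝ, E₁) ∞ (M₁ L)]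

/-- `d(h₁ ∘ γ₁) = ω₁(X, Tγ₁ ·)` for a solution `X` of `i_X ω₁ = dh₁`. -/
theorem IsGlobalDynamics.mfderiv_h₁_restrict₁ (hL : IsAlmostRegular E₁ L)
    {X : ∀ p : M₁ L, TangentSpace 𝓘(ℝ, E₁) p} (hX : IsGlobalDynamics E₁ L X)
    {γ : ∀ q : Q, CotangentSpace E Q q}
    (hγ : ContMDiff 𝓘(ℝ, E) (modelTstarQ E) ∞ (formMap γ))
    (hγM : range (formMap γ) ⊆ range (legendre L)) (q : Q) (u : TangentSpace 𝓘(ℝ, E) q) :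
    mfderiv 𝓘(ℝ, E) 𝓘(ℝ, ℝ) (fun q' => h₁ L (restrict₁ L γ hγM q')) q u =
      canonicalForm (formMap γ q)
        (mfderiv 𝓘(ℝ, E₁) (modelTstarQ E) (incl L) (restrict₁ L γ hγM q)
          (X (restrict₁ L γ hγM q)))
        (mfderiv 𝓘(ℝ, E) (modelTstarQ E) (formMap γ) q u) := by
  have := mfderiv_comp q (hL.contMDiff_h₁.mdifferentiableAt (x := restrict₁ L γ hγM q) (by simp))
    ((hL.contMDiff_restrict₁ hγ hγM).mdifferentiableAt (x := q) (by simp))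
  refine (DFunLike.congr_fun this u).trans ?_
  refine (hX.equation (restrict₁ L γ hγM q) _).symm.trans ?_
  exact congrArg (canonicalForm (formMap γ q) _) (hL.mfderiv_incl_restrict₁ hγ hγM q u)

/-- `X^γ` and `X` are `γ₁`-related if and only if `h₁ ∘ γ₁` has zero differential. -/
theorem IsAlmostRegular.areRelated_iff (hL : IsAlmostRegular E₁ L)
    {X : ∀ p : M₁ L, TangentSpace 𝓘(ℝ, E₁) p} (hX : IsGlobalDynamics E₁ L X)
    {γ : ∀ q : Q, CotangentSpace E Q q} (hγ : IsClosedOneForm γ)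
    (hγM : range (formMap γ) ⊆ range (legendre L)) :
    AreRelated 𝓘(ℝ, E) 𝓘(ℝ, E₁) (restrict₁ L γ hγM) (projectedField E₁ L X γ hγM) X ↔
      ∀ q : Q, mfderiv 𝓘(ℝ, E) 𝓘(ℝ, ℝ)
        (fun q' => h₁ L (restrict₁ L γ hγM q')) q = 0 := by
  refine forall_congr' fun q => ⟨fun h => ?_, fun h => ?_⟩
  · refine ContinuousLinearMap.ext fun u => ?_
    refine (hX.mfderiv_h₁_restrict₁ hL hγ.smooth hγM q u).trans ?_
    -- Now both arguments of `ω_Q` are tangent to the image of `γ`.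
    rw [← h, hL.mfderiv_incl_restrict₁ hγ.smooth hγM]
    exact canonicalForm_mfderiv_formMap hγ q _ u
  · apply (hL.embedding.isImmersion.isImmersionAt _).mfderiv_injective (by simp)
    rw [hL.mfderiv_incl_restrict₁ hγ.smooth hγM]
    let Y : E := projectedField E₁ L X γ hγM q
    let Z : E × (E →L[ℝ] ℝ) := mfderiv 𝓘(ℝ, E₁) (modelTstarQ E) (incl L)
      (restrict₁ L γ hγM q) (X (restrict₁ L γ hγM q))
    let G : E → E × (E →L[ℝ] ℝ) := mfderiv 𝓘(ℝ, E) (modelTstarQ E) (formMap γ) q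
    have hG : ∀ u, (G u).1 = u := fun u => congrArg Prod.fst (mfderiv_formMap hγ.smooth q u)
    have hYZ : Y = Z.1 := hL.mfderiv_proj₁ _ _
    change G Y = Z
    -- The base components agree by the definition of `X^γ`; the momentum components are compared by
    -- pairing both vectors with `G u`.
    refine Prod.ext ((hG Y).trans hYZ) (ContinuousLinearMap.ext fun u => ?_)
    have h1 : (G u).2 (G Y).1 - (G Y).2 (G u).1 = 0 :=
      (canonicalForm_eq _ _ _).symm.trans (canonicalForm_mfderiv_formMap hγ q Y u)
    have h2 : (G u).2 Z.1 - Z.2 (G u).1 = 0 :=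
      (canonicalForm_eq _ _ _).symm.trans
        ((hX.mfderiv_h₁_restrict₁ hL hγ.smooth hγM q u).symm.trans (DFunLike.congr_fun h u))
    rw [hG, hG, hYZ] at h1
    rw [hG] at h2
    exact hYZ ▸ sub_right_injective (h1.trans h2.symm)

end ConstraintSet

end SingularHJ

end

theorem mainTheorem1
    {E Q E₁ : Type*} [NormedAddCommGroup E] [NormedSpace ℝ E] [FiniteDimensional ℝ E]
    [TopologicalSpace Q] [ChartedSpace E Q] [IsManifold 𝓘(ℝ, E) ∞ Q]
    [NormedAddCommGroup E₁] [NormedSpace ℝ E₁] [FiniteDimensional ℝ E₁]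
    (L : SingularHJ.TQ E Q → ℝ)
    [ChartedSpace E₁ (SingularHJ.M₁ L)] [IsManifold 𝓘(ℝ, E₁) ∞ (SingularHJ.M₁ L)]
    (hL : SingularHJ.IsAlmostRegular E₁ L)
    (X : ∀ p : SingularHJ.M₁ L, TangentSpace 𝓘(ℝ, E₁) p)
    (hX : SingularHJ.IsGlobalDynamics E₁ L X)
    (γ : ∀ q : Q, SingularHJ.CotangentSpace E Q q)
    (hγ : SingularHJ.IsClosedOneForm γ)
    (hγM : range (SingularHJ.formMap γ) ⊆ range (SingularHJ.legendre L)) :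
    (∀ v : SingularHJ.TQ E Q,
        SingularHJ.h₁ L (SingularHJ.legendre₁ L v) = SingularHJ.energy L v) ∧
    ContMDiff 𝓘(ℝ, E₁) 𝓘(ℝ, ℝ) ∞ (SingularHJ.h₁ L) ∧
    ContMDiff 𝓘(ℝ, E) 𝓘(ℝ, E₁) ∞ (SingularHJ.restrict₁ L γ hγM) ∧
    (SingularHJ.AreRelated 𝓘(ℝ, E) 𝓘(ℝ, E₁) (SingularHJ.restrict₁ L γ hγM)
        (SingularHJ.projectedField E₁ L X γ hγM) X ↔
      ∀ q : Q, mfderiv 𝓘(ℝ, E) 𝓘(ℝ, ℝ)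
        (fun q' => SingularHJ.h₁ L (SingularHJ.restrict₁ L γ hγM q')) q = 0) :=
  ⟨hL.h₁_legendre₁, hL.contMDiff_h₁, hL.contMDiff_restrict₁ hγ.smooth hγM,
    hL.areRelated_iff hX hγ hγM⟩
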